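/- Theorem 1.1. Let $s\ge 2$ be an integer. Then there exists a pseudo-Riemannian manifold $(M,g)$ of signature $(2s,s)$ (that is, with $2s$ timelike (negative) and $s$ spacelike (positive) directions) that is spacelike Jordan Osserman and nilpotent Osserman of order $3$, but is not timelike Jordan Osserman. More precisely, one can take $M=\mathbb{R}^{3s}$ with coordinates $(u_1,\dots,u_s,v_1,\dots,v_s,t_1,\dots,t_s)$ and coordinate vector fields $U_a=\partial/\partial u_a$, $V_a=\partial/\partial v_a$, $T_a=\partial/\partial t_a$, and a smooth metric $g$ whose only non-zero components are $$g(U_a,U_b)=\sum_{c,d=1}^{s}\psi_{abcd}\,u_c t_d,\qquad g(U_a,V_b)=g(V_b,U_a)=\delta_{ab},\qquad g(T_a,T_b)=-\delta_{ab},$$ for suitable real constants $\psi_{abcd}$ with $\psi_{abcd}=\psi_{bacd}$. Here $R(x,y)=\nabla_x\nabla_y-\nabla_y\nabla_x-\nabla_{[x,y]}$ is the curvature of the Levi-Civita connection, $R(x,y,z,w)=g(R(x,y)z,w)$, and for $x\in T_PM$ the Jacobi operator $J(x):T_PM\to T_PM$ is the linear map with $g(J(x)y,z)=R(y,x,x,z)$.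 The manifold is spacelike (respectively timelike) Jordan Osserman if the (complex) Jordan normal form of $J(x)$, up to the order of the blocks, is the same for all $x\in TM$ with $g(x,x)=1$ (respectively $g(x,x)=-1$), at all points of $M$. It is nilpotent Osserman of order $n$ if $J(x)^{\dim M}=0$ for every $x\in TM$ and $n=\sup_{x\in TM}n(x)$, where $n(x)\ge 1$ is the least integer with $J(x)^{n(x)}=0$. -/

import Mathlib

open scoped ContDiff TensorProduct

noncomputable section

/-- A smooth pseudo-Riemannian metric on the coordinate space `ι → ℝ`; `g.comp P i j` is the
component `g(∂ᵢ, ∂ⱼ)` at the point `P`. -/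
structure PseudoRiemannianMetric (ι : Type*) [Fintype ι] [DecidableEq ι] where
  comp : (ι → ℝ) → Matrix ι ι ℝ
  smooth : ∀ i j, ContDiff ℝ ∞ (fun P => comp P i j)
  symm : ∀ P i j, comp P i j = comp P j i
  nondegenerate : ∀ P, (comp P).det ≠ 0

namespace PseudoRiemannianMetric

variable {ι : Type*} [Fintype ι] [DecidableEq ι]

/-- The scalar product `g_P(x, y)` of two tangent vectors at `P`. -/
def prod (g : PseudoRiemannianMetric ι) (P x y : ι → ℝ) : ℝ :=
  ∑ i, ∑ j, g.comp P i j * x i * y j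

/-- `g` has signature `(p, q)`: every tangent space has a basis consisting of `p` timelike and `q`
spacelike vectors that are pairwise orthogonal and of square `-1` and `+1` respectively. -/
def HasSignature (g : PseudoRiemannianMetric ι) (p q : ℕ) : Prop :=
  ∀ P, ∃ b : Module.Basis (Fin p ⊕ Fin q) ℝ (ι → ℝ),
    (∀ i j, i ≠ j → g.prod P (b i) (b j) = 0) ∧
    (∀ i, g.prod P (b (Sum.inl i)) (b (Sum.inl i)) = -1) ∧
    (∀ i, g.prod P (b (Sum.inr i)) (b (Sum.inr i)) = 1)

/-- The partial derivative `∂ᵢ f` at `P`. -/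
def partialDeriv (i : ι) (f : (ι → ℝ) → ℝ) (P : ι → ℝ) : ℝ :=
  fderiv ℝ f P (Pi.single i 1)

/-- The Christoffel symbols `Γᵏᵢⱼ` of the Levi-Civita connection, `∇_{∂ᵢ} ∂ⱼ = ∑ₖ Γᵏᵢⱼ ∂ₖ`. -/
def christoffel (g : PseudoRiemannianMetric ι) (k i j : ι) (P : ι → ℝ) : ℝ :=
  (1 / 2) * ∑ l, (g.comp P)⁻¹ k l *
    (partialDeriv i (fun Q => g.comp Q j l) P + partialDeriv j (fun Q => g.comp Q i l) P
      - partialDeriv l (fun Q => g.comp Q i j) P)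

/-- The components `Rˡᵢⱼₖ` of the curvature, `R(∂ᵢ, ∂ⱼ) ∂ₖ = ∑ₗ Rˡᵢⱼₖ ∂ₗ`, where
`R(X, Y) = ∇_X ∇_Y - ∇_Y ∇_X - ∇_[X, Y]`. -/
def curvatureComp (g : PseudoRiemannianMetric ι) (P : ι → ℝ) (l i j k : ι) : ℝ :=
  partialDeriv i (g.christoffel l j k) P - partialDeriv j (g.christoffel l i k) P
    + ∑ m, (g.christoffel l i m P * g.christoffel m j k P
      - g.christoffel l j m P * g.christoffel m i k P)

/-- The tangent vector `R(x, y) z` at `P`. -/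
def curvatureOp (g : PseudoRiemannianMetric ι) (P x y z : ι → ℝ) : ι → ℝ :=
  fun l => ∑ i, ∑ j, ∑ k, g.curvatureComp P l i j k * x i * y j * z k

/-- The curvature tensor `R(x, y, z, w) = g(R(x, y) z, w)` at `P`. -/
def curvature (g : PseudoRiemannianMetric ι) (P x y z w : ι → ℝ) : ℝ :=
  g.prod P (g.curvatureOp P x y z) w

/-- The Jacobi operator `J(x) : y ↦ R(y, x) x` at `P`. -/
def jacobi (g : PseudoRiemannianMetric ι) (P x : ι → ℝ) : (ι → ℝ) →ₗ[ℝ] (ι → ℝ) where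
  toFun y := g.curvatureOp P y x x
  map_add' y z := by
    funext l
    simp only [curvatureOp, Pi.add_apply, mul_add, add_mul, Finset.sum_add_distrib]
  map_smul' c y := by
    funext l
    simp only [curvatureOp, Pi.smul_apply, smul_eq_mul, RingHom.id_apply, Finset.mul_sum]
    refine Finset.sum_congr rfl fun i _ => Finset.sum_congr rfl fun j _ =>
      Finset.sum_congr rfl fun k _ => ?_
    ring

/-- The identity that characterizes the Jacobi operator. -/
theorem prod_jacobi (g : PseudoRiemannianMetric ι) (P x y z : ι → ℝ) :
    g.prod P (g.jacobi P x y) z = g.curvature P y x x z := rfl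

end PseudoRiemannianMetric

/-- The data of a Jordan normal form: a finite list of blocks, each with its eigenvalue and size. -/
structure JordanData where
  numBlocks : ℕ
  eigenvalue : Fin numBlocks → ℂ
  size : Fin numBlocks → ℕ
  size_pos : ∀ i, 0 < size i

/-- The `k × k` Jordan block with eigenvalue `c`, with ones on the superdiagonal. -/
def jordanBlock (c : ℂ) (k : ℕ) : Matrix (Fin k) (Fin k) ℂ :=
  Matrix.of fun i j => if i = j then c else if i.val + 1 = j.val then 1 else 0

/-- The block diagonal Jordan matrix with the given blocks. -/
def JordanData.matrix (D : JordanData) :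
    Matrix ((i : Fin D.numBlocks) × Fin (D.size i)) ((i : Fin D.numBlocks) × Fin (D.size i)) ℂ :=
  Matrix.blockDiagonal' fun i => jordanBlock (D.eigenvalue i) (D.size i)

/-- `D` is the Jordan normal form of the real operator `A`: in some basis of the complexification,
the complexified operator is given by the Jordan matrix of `D`. -/
def HasJordanForm {V : Type*} [AddCommGroup V] [Module ℝ V] (A : V →ₗ[ℝ] V)
    (D : JordanData) : Prop :=
  ∃ b : Module.Basis ((i : Fin D.numBlocks) × Fin (D.size i)) ℂ (ℂ ⊗[ℝ] V),
    LinearMap.toMatrix b b (A.baseChange ℂ) = D.matrix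

namespace PseudoRiemannianMetric

variable {ι : Type*} [Fintype ι] [DecidableEq ι]

/-- The Jordan normal form of `J(x)` is constant on the bundle of unit spacelike vectors. -/
def IsSpacelikeJordanOsserman (g : PseudoRiemannianMetric ι) : Prop :=
  ∃ D : JordanData, ∀ P x, g.prod P x x = 1 → HasJordanForm (g.jacobi P x) D

/-- The Jordan normal form of `J(x)` is constant on the bundle of unit timelike vectors. -/
def IsTimelikeJordanOsserman (g : PseudoRiemannianMetric ι) : Prop :=
  ∃ D : JordanData, ∀ P x, g.prod P x x = -1 → HasJordanForm (g.jacobi P x) D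

/-- `g` is nilpotent Osserman of order `n`: every `J(x)` is nilpotent, and `n` is the supremum over
all tangent vectors `x` of the least exponent `n(x)` with `J(x) ^ n(x) = 0`. -/
def IsNilpotentOssermanOfOrder (g : PseudoRiemannianMetric ι) (n : ℕ) : Prop :=
  (∀ P x, g.jacobi P x ^ Fintype.card ι = 0) ∧
    IsLUB {m : ℕ | ∃ P x, m = nilpotencyClass (g.jacobi P x)} n

end PseudoRiemannianMetric

/-- Indices of the coordinates `(u₁, …, u_s, v₁, …, v_s, t₁, …, t_s)` of `ℝ^{3s}`. -/
abbrev UVT (s : ℕ) : Type := Fin s ⊕ Fin s ⊕ Fin s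

namespace UVT

variable {s : ℕ}

/-- The index of the coordinate `u_a`. -/
abbrev u (a : Fin s) : UVT s := Sum.inl a

/-- The index of the coordinate `v_a`. -/
abbrev v (a : Fin s) : UVT s := Sum.inr (Sum.inl a)

/-- The index of the coordinate `t_a`. -/
abbrev t (a : Fin s) : UVT s := Sum.inr (Sum.inr a)

end UVT

/-- The components of `g` are `g(U_a, U_b) = ∑_{c,d} ψ_{abcd} u_c t_d`,
`g(U_a, V_b) = g(V_b, U_a) = δ_{ab}`, `g(T_a, T_b) = -δ_{ab}`, and zero otherwise. -/
def HasQuadraticForm {s : ℕ} (g : PseudoRiemannianMetric (UVT s))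
    (ψ : Fin s → Fin s → Fin s → Fin s → ℝ) : Prop :=
  ∀ (P : UVT s → ℝ) (a b : Fin s),
    g.comp P (UVT.u a) (UVT.u b) = ∑ c, ∑ d, ψ a b c d * P (UVT.u c) * P (UVT.t d) ∧
    g.comp P (UVT.u a) (UVT.v b) = (if a = b then 1 else 0) ∧
    g.comp P (UVT.v b) (UVT.u a) = (if a = b then 1 else 0) ∧
    g.comp P (UVT.t a) (UVT.t b) = (if a = b then -1 else 0) ∧
    g.comp P (UVT.u a) (UVT.t b) = 0 ∧ g.comp P (UVT.t b) (UVT.u a) = 0 ∧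
    g.comp P (UVT.v a) (UVT.v b) = 0 ∧
    g.comp P (UVT.v a) (UVT.t b) = 0 ∧ g.comp P (UVT.t b) (UVT.v a) = 0

end

/-! Take `ψ a b c d = 2 δ_ab δ_cd`, so that g = 2⟨u,t⟩|du|² + 2⟨du,dv⟩ - |dt|². Write x = (ξ, ν, τ)
for the u-, v- and t-parts, and K_ξ η = |ξ|² η - ⟨η,ξ⟩ ξ (`sphereJacobi`). By `jacobi_metric`, J(x)
maps the u-part η to K_ξ η in the t-part, the t-part θ to -K_ξ θ in the v-part, adds a v-term linear
in η, and kills v. Hence J(x)³ = 0. If ξ ≠ 0, K_ξ is |ξ|² on ξ^⊥ and 0 on ξ, so the Jordan form is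
always s - 1 blocks of size three and three of size one (`hasJordanForm_jacobi`). If ξ = 0, J(x) =
0. A spacelike x has ξ ≠ 0 because the t-directions are negative; timelike vectors occur in both
classes. For s ≥ 2 these two classes have different Jordan forms. -/

namespace PseudoRiemannianMetric

/-! ### Calculus of partial derivatives. -/

section PartialDeriv

variable {ι : Type*} [DecidableEq ι]

theorem partialDeriv_const (i : ι) (c : ℝ) (P : ι → ℝ) :
    partialDeriv i (fun _ => c) P = 0 := by
  simp [partialDeriv]

theorem partialDeriv_coord (i j : ι) (P : ι → ℝ) :
    partialDeriv i (fun Q => Q j) P = if j = i then 1 else 0 := by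
  have h : HasFDerivAt (fun Q : ι → ℝ => Q j) (ContinuousLinearMap.proj (R := ℝ) j) P :=
    (ContinuousLinearMap.proj (R := ℝ) (φ := fun _ : ι => ℝ) j).hasFDerivAt
  rw [partialDeriv, h.fderiv]
  simp [Pi.single_apply]

variable [Fintype ι]

theorem partialDeriv_add (i : ι) {f f' : (ι → ℝ) → ℝ} {P : ι → ℝ}
    (hf : DifferentiableAt ℝ f P) (hf' : DifferentiableAt ℝ f' P) :
    partialDeriv i (fun Q => f Q + f' Q) P = partialDeriv i f P + partialDeriv i f' P := by
  simp [partialDeriv, fderiv_fun_add hf hf']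

theorem partialDeriv_sub (i : ι) {f f' : (ι → ℝ) → ℝ} {P : ι → ℝ}
    (hf : DifferentiableAt ℝ f P) (hf' : DifferentiableAt ℝ f' P) :
    partialDeriv i (fun Q => f Q - f' Q) P = partialDeriv i f P - partialDeriv i f' P := by
  simp [partialDeriv, fderiv_fun_sub hf hf']

theorem partialDeriv_mul (i : ι) {f f' : (ι → ℝ) → ℝ} {P : ι → ℝ}
    (hf : DifferentiableAt ℝ f P) (hf' : DifferentiableAt ℝ f' P) :
    partialDeriv i (fun Q => f Q * f' Q) P
      = f P * partialDeriv i f' P + f' P * partialDeriv i f P := by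
  simp [partialDeriv, fderiv_fun_mul hf hf']

theorem partialDeriv_sum {κ : Type*} (i : ι) (t : Finset κ) {f : κ → (ι → ℝ) → ℝ} {P : ι → ℝ}
    (hf : ∀ k ∈ t, DifferentiableAt ℝ (f k) P) :
    partialDeriv i (fun Q => ∑ k ∈ t, f k Q) P = ∑ k ∈ t, partialDeriv i (f k) P := by
  simp [partialDeriv, fderiv_fun_sum hf]

end PartialDeriv

end PseudoRiemannianMetric

/-! ### The metric, its Christoffel symbols and its curvature. -/

namespace WalkerMetric

open PseudoRiemannianMetric

variable {s : ℕ}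

/-- The function `2 ⟨u, t⟩`. -/
def potential (P : UVT s → ℝ) : ℝ := ∑ c, 2 * P (UVT.u c) * P (UVT.t c)

/-- The components of `2 ⟨u, t⟩ |du|² + 2 ⟨du, dv⟩ - |dt|²`. -/
def metricComp (P : UVT s → ℝ) : Matrix (UVT s) (UVT s) ℝ
  | .inl a, .inl b => if a = b then potential P else 0
  | .inl a, .inr (.inl b) => if a = b then 1 else 0
  | .inr (.inl a), .inl b => if a = b then 1 else 0
  | .inr (.inr a), .inr (.inr b) => if a = b then -1 else 0
  | _, _ => 0

/-- The inverse of `metricComp`. -/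
def metricInv (P : UVT s → ℝ) : Matrix (UVT s) (UVT s) ℝ
  | .inr (.inl a), .inr (.inl b) => if a = b then -potential P else 0
  | .inl a, .inr (.inl b) => if a = b then 1 else 0
  | .inr (.inl a), .inl b => if a = b then 1 else 0
  | .inr (.inr a), .inr (.inr b) => if a = b then -1 else 0
  | _, _ => 0

theorem metricComp_mul_metricInv (P : UVT s → ℝ) : metricComp P * metricInv P = 1 := by
  ext i j
  rcases i with i | i | i <;> rcases j with j | j | j <;>
    simp [Matrix.mul_apply, Fintype.sum_sum_type, metricComp, metricInv, Matrix.one_apply]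
  split_ifs <;> simp

/-- The metric `2 ⟨u, t⟩ |du|² + 2 ⟨du, dv⟩ - |dt|²` on `ℝ^{3s}`. -/
def metric (s : ℕ) : PseudoRiemannianMetric (UVT s) where
  comp := metricComp
  smooth i j := by
    have h : ContDiff ℝ ∞ (potential (s := s)) := by
      unfold potential
      fun_prop
    rcases i with i | i | i <;> rcases j with j | j | j <;> simp only [metricComp] <;>
      try exact contDiff_const
    split_ifs
    · exact h
    · exact contDiff_const
  symm P i j := by
    rcases i with i | i | i <;> rcases j with j | j | j <;> simp [metricComp, eq_comm]
  nondegenerate P h := by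
    have := congrArg Matrix.det (metricComp_mul_metricInv P)
    simp [h] at this

theorem metric_comp_inv (P : UVT s → ℝ) : ((metric s).comp P)⁻¹ = metricInv P :=
  Matrix.inv_eq_right_inv (metricComp_mul_metricInv P)

/-- The partial derivatives of `potential`. -/
def potentialDeriv (P : UVT s → ℝ) : UVT s → ℝ
  | .inl a => 2 * P (UVT.t a)
  | .inr (.inl _) => 0
  | .inr (.inr a) => 2 * P (UVT.u a)

theorem partialDeriv_potential (i : UVT s) (P : UVT s → ℝ) :
    partialDeriv i potential P = potentialDeriv P i := by
  unfold potential
  rw [partialDeriv_sum _ _ (fun k _ => by fun_prop)]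
  have h (c : Fin s) : partialDeriv i (fun Q : UVT s → ℝ => 2 * Q (UVT.u c) * Q (UVT.t c)) P
      = 2 * P (UVT.u c) * (if UVT.t c = i then 1 else 0)
        + P (UVT.t c) * (2 * (if UVT.u c = i then 1 else 0)) := by
    rw [partialDeriv_mul _ (by fun_prop) (by fun_prop),
      partialDeriv_mul _ (by fun_prop) (by fun_prop), partialDeriv_coord, partialDeriv_coord,
      partialDeriv_const]
    ring
  simp only [h]
  rcases i with i | i | i <;> simp [potentialDeriv, mul_comm]

theorem partialDeriv_metricComp (i j l : UVT s) (P : UVT s → ℝ) :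
    partialDeriv i (fun Q => metricComp Q j l) P
      = match j, l with
        | .inl a, .inl b => if a = b then potentialDeriv P i else 0
        | _, _ => 0 := by
  rcases j with j | j | j <;> rcases l with l | l | l <;>
    simp only [metricComp, partialDeriv_const]
  split_ifs
  · exact partialDeriv_potential i P
  · exact partialDeriv_const i 0 P

/-- The Christoffel symbols of `metric`. -/
def connection (P : UVT s → ℝ) : UVT s → UVT s → UVT s → ℝ
  | .inr (.inl c), .inl a, .inl b =>
      P (UVT.t a) * (if b = c then 1 else 0) + P (UVT.t b) * (if a = c then 1 else 0)
        - P (UVT.t c) * (if a = b then 1 else 0)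
  | .inr (.inl c), .inl a, .inr (.inr d) => P (UVT.u d) * (if a = c then 1 else 0)
  | .inr (.inl c), .inr (.inr d), .inl a => P (UVT.u d) * (if a = c then 1 else 0)
  | .inr (.inr d), .inl a, .inl b => P (UVT.u d) * (if a = b then 1 else 0)
  | _, _, _ => 0

theorem christoffel_metric (k i j : UVT s) :
    (metric s).christoffel k i j = fun P => connection P k i j := by
  funext P
  rw [christoffel, metric_comp_inv]
  simp only [metric, partialDeriv_metricComp]
  rcases k with k | k | k <;> rcases i with i | i | i <;> rcases j with j | j | j <;>
    simp [Fintype.sum_sum_type, metricInv, connection, potentialDeriv]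
  all_goals split_ifs <;> first | (exfalso; grind) | ring

/-- The components `Rˡᵢⱼₖ` of the curvature of `metric`. -/
def curvatureTensor (P : UVT s → ℝ) : UVT s → UVT s → UVT s → UVT s → ℝ
  | .inr (.inr d), .inl a, .inl b, .inl c =>
      (if a = d then 1 else 0) * (if b = c then 1 else 0)
        - (if b = d then 1 else 0) * (if a = c then 1 else 0)
  | .inr (.inl l), .inl a, .inl b, .inl c =>
      (∑ e, P (UVT.u e) ^ 2) * ((if a = l then 1 else 0) * (if b = c then 1 else 0)
        - (if b = l then 1 else 0) * (if a = c then 1 else 0))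
  | .inr (.inl l), .inl a, .inl b, .inr (.inr c) =>
      (if a = c then 1 else 0) * (if b = l then 1 else 0)
        - (if b = c then 1 else 0) * (if a = l then 1 else 0)
  | .inr (.inl l), .inl a, .inr (.inr b), .inl c =>
      (if b = l then 1 else 0) * (if a = c then 1 else 0)
        - (if b = c then 1 else 0) * (if a = l then 1 else 0)
  | .inr (.inl l), .inr (.inr b), .inl a, .inl c =>
      (if b = c then 1 else 0) * (if a = l then 1 else 0)
        - (if b = l then 1 else 0) * (if a = c then 1 else 0)
  | _, _, _, _ => 0

/-- The partial derivatives of the Christoffel symbols of `metric`. -/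
def connectionDeriv : UVT s → UVT s → UVT s → UVT s → ℝ
  | .inr (.inr e), .inr (.inl c), .inl a, .inl b =>
      (if a = e then 1 else 0) * (if b = c then 1 else 0)
        + (if b = e then 1 else 0) * (if a = c then 1 else 0)
        - (if c = e then 1 else 0) * (if a = b then 1 else 0)
  | .inl e, .inr (.inl c), .inl a, .inr (.inr d) =>
      (if d = e then 1 else 0) * (if a = c then 1 else 0)
  | .inl e, .inr (.inl c), .inr (.inr d), .inl a =>
      (if d = e then 1 else 0) * (if a = c then 1 else 0)
  | .inl e, .inr (.inr d), .inl a, .inl b =>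
      (if d = e then 1 else 0) * (if a = b then 1 else 0)
  | _, _, _, _ => 0

theorem partialDeriv_coord_mul_const (i j : UVT s) (c : ℝ) (P : UVT s → ℝ) :
    partialDeriv i (fun Q => Q j * c) P = (if j = i then 1 else 0) * c := by
  rw [partialDeriv_mul _ (by fun_prop) (by fun_prop), partialDeriv_coord, partialDeriv_const]
  ring

theorem partialDeriv_connection (e k i j : UVT s) (P : UVT s → ℝ) :
    partialDeriv e (fun Q => connection Q k i j) P = connectionDeriv e k i j := by
  rcases k with k | k | k <;> rcases i with i | i | i <;> rcases j with j | j | j <;>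
    simp only [connection, partialDeriv_const, partialDeriv_coord_mul_const]
  case inr.inl.inl.inl =>
    rw [partialDeriv_sub _ (by fun_prop) (by fun_prop),
      partialDeriv_add _ (by fun_prop) (by fun_prop)]
    simp only [partialDeriv_coord_mul_const]
    rcases e with e | e | e <;> simp [connectionDeriv]
  all_goals rcases e with e | e | e <;> simp [connectionDeriv]

set_option maxHeartbeats 1000000 in
theorem curvatureComp_metric (P : UVT s → ℝ) (l i j k : UVT s) :
    (metric s).curvatureComp P l i j k = curvatureTensor P l i j k := by
  rw [curvatureComp]
  simp only [christoffel_metric, partialDeriv_connection]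
  rcases l with l | l | l <;> rcases i with i | i | i <;> rcases j with j | j | j <;>
    rcases k with k | k | k <;>
    simp only [Fintype.sum_sum_type, connection, connectionDeriv, curvatureTensor, mul_zero,
      zero_mul, sub_zero, Finset.sum_const_zero, add_zero, zero_add, zero_sub, neg_zero]
  -- The only components where products of Christoffel symbols survive: Γ^v_{ut} Γ^t_{uu}, summed
  -- over the t-index, gives the factor |u|².
  case inr.inl.inl.inl.inl =>
    rw [Finset.sum_mul]
    exact Finset.sum_congr rfl fun _ _ => by ring
  all_goals split_ifs <;> first | (exfalso; grind) | norm_num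

end WalkerMetric

/-! ### Jordan forms of nilpotent operators. -/

section JordanForm

variable {V : Type*} [AddCommGroup V] [Module ℝ V]

/-- A real basis made of Jordan chains for the eigenvalue zero yields the Jordan form. -/
theorem HasJordanForm.of_nilpotent_chains {A : V →ₗ[ℝ] V} {D : JordanData}
    (hD : ∀ i, D.eigenvalue i = 0)
    (b : Module.Basis ((i : Fin D.numBlocks) × Fin (D.size i)) ℝ V)
    (hzero : ∀ i (h : 0 < D.size i), A (b ⟨i, 0, h⟩) = 0)
    (hsucc : ∀ i k (h : k + 1 < D.size i),
      A (b ⟨i, k + 1, h⟩) = b ⟨i, k, (Nat.lt_succ_self k).trans h⟩) :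
    HasJordanForm A D := by
  refine ⟨Algebra.TensorProduct.basis ℂ b, ?_⟩
  rw [LinearMap.toMatrix_baseChange]
  ext ⟨i, k⟩ ⟨j, l⟩
  rw [Matrix.map_apply, LinearMap.toMatrix_apply, JordanData.matrix]
  obtain ⟨l, hl⟩ := l
  by_cases h : i = j
  · subst h
    rw [Matrix.blockDiagonal'_apply_eq]
    cases l with
    | zero =>
      rw [hzero]
      simp [jordanBlock, hD]
    | succ l =>
      rw [hsucc]
      simp [jordanBlock, hD, Finsupp.single_apply, Fin.ext_iff, eq_comm]
      omega
  · rw [Matrix.blockDiagonal'_apply_ne _ _ _ h]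
    cases l with
    | zero =>
      rw [hzero]
      simp
    | succ l =>
      rw [hsucc, b.repr_self, Finsupp.single_eq_of_ne (fun e => h (congrArg Sigma.fst e)), map_zero]

/-- The zero operator has zero matrix in every basis, so `D.matrix` vanishes and with it the
complexification of `A`; faithful flatness of ℂ over ℝ descends this to `A`. -/
theorem HasJordanForm.eq_zero_of_zero {A : V →ₗ[ℝ] V} {D : JordanData}
    (h₀ : HasJordanForm (0 : V →ₗ[ℝ] V) D) (hA : HasJordanForm A D) : A = 0 := by
  obtain ⟨b₀, hb₀⟩ := h₀
  obtain ⟨b, hb⟩ := hA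
  rw [LinearMap.baseChange_zero, map_zero] at hb₀
  rw [← hb₀, LinearEquiv.map_eq_zero_iff] at hb
  ext y
  have h := LinearMap.congr_fun hb (1 ⊗ₜ y)
  rw [LinearMap.baseChange_tmul, LinearMap.zero_apply] at h
  exact (Module.FaithfullyFlat.one_tmul_eq_zero_iff ℝ V _).1 h

/-- The nilpotent Jordan data with `m` blocks of size three and `n` blocks of size one. -/
def JordanData.threeOne (m n : ℕ) : JordanData where
  numBlocks := m + n
  eigenvalue _ := 0
  size := Fin.append (fun _ => 3) (fun _ => 1)
  size_pos i := by
    refine Fin.addCases (fun i => ?_) (fun i => ?_) i <;> simp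

/-- A spanning family with as many members as the dimension is a basis, so independence of the
chains need not be checked. -/
theorem HasJordanForm.threeOne {A : V →ₗ[ℝ] V} {m n : ℕ} (w : Fin m → V) (z : Fin n → V)
    (hw : ∀ i, A (A (A (w i))) = 0) (hz : ∀ i, A (z i) = 0)
    (hrank : Module.finrank ℝ V = 3 * m + n)
    (hspan : ∀ S : Submodule ℝ V, (∀ i, w i ∈ S) → (∀ i, A (w i) ∈ S) →
      (∀ i, A (A (w i)) ∈ S) → (∀ i, z i ∈ S) → S = ⊤) :
    HasJordanForm A (JordanData.threeOne m n) := by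
  -- Chains are listed from the kernel upwards, since the Jordan blocks carry their ones above the
  -- diagonal.
  let chain : Fin (m + n) → ℕ → V :=
    Fin.addCases (motive := fun _ => ℕ → V) (fun i k => (A ^ (2 - k)) (w i)) (fun i _ => z i)
  let f : ((i : Fin (JordanData.threeOne m n).numBlocks) ×
      Fin ((JordanData.threeOne m n).size i)) → V := fun p => chain p.1 p.2.val
  have hmem (i : Fin (m + n)) (k : ℕ) (hk : k < (JordanData.threeOne m n).size i) :
      chain i k ∈ Submodule.span ℝ (Set.range f) :=
    Submodule.subset_span ⟨⟨i, k, hk⟩, rfl⟩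
  have hchain (i : Fin m) (k : ℕ) (hk : k < 3) :
      (A ^ (2 - k)) (w i) ∈ Submodule.span ℝ (Set.range f) := by
    simpa [chain] using hmem (Fin.castAdd n i) k (by simpa [JordanData.threeOne] using hk)
  have htop : Submodule.span ℝ (Set.range f) = ⊤ := by
    refine hspan _ (fun i => ?_) (fun i => ?_) (fun i => ?_) (fun i => ?_)
    · simpa using hchain i 2 (by norm_num)
    · simpa using hchain i 1 (by norm_num)
    · simpa [pow_two] using hchain i 0 (by norm_num)
    · simpa [chain] using hmem (Fin.natAdd m i) 0 (by simp [JordanData.threeOne])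
  have hcard : Fintype.card ((i : Fin (JordanData.threeOne m n).numBlocks) ×
      Fin ((JordanData.threeOne m n).size i)) = Module.finrank ℝ V := by
    rw [Fintype.card_sigma, hrank]
    change ∑ i : Fin (m + n), Fintype.card (Fin (Fin.append (fun _ => 3) (fun _ => 1) i)) = _
    rw [Fin.sum_univ_add]
    simp [mul_comm]
  have hb (p) : basisOfTopLeSpanOfCardEqFinrank f htop.ge hcard p = f p := by
    rw [coe_basisOfTopLeSpanOfCardEqFinrank]
  refine of_nilpotent_chains (fun _ => rfl) (basisOfTopLeSpanOfCardEqFinrank f htop.ge hcard)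
    (fun i h => ?_) (fun i k h => ?_)
  · rw [hb]
    change A (chain i 0) = 0
    refine Fin.addCases (fun i => ?_) (fun i => ?_) i
    · simpa [chain, pow_two] using hw i
    · simpa [chain] using hz i
  · rw [hb, hb]
    change A (chain i (k + 1)) = chain i k
    revert h
    refine Fin.addCases (fun i h => ?_) (fun i h => ?_) i
    · have h' : k + 1 < 3 := by simpa [JordanData.threeOne] using h
      have : 2 - k = (2 - (k + 1)) + 1 := by omega
      simp [chain, this, pow_succ', Module.End.mul_apply]
    · simp [JordanData.threeOne] at h

end JordanForm

/-! ### The Jacobi operator and the Osserman properties. -/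

namespace WalkerMetric

open PseudoRiemannianMetric

variable {s : ℕ}

/-- The tangent vector with the given components along the `u`, `v` and `t` directions. -/
abbrev vec (ξ ν τ : Fin s → ℝ) : UVT s → ℝ := Sum.elim ξ (Sum.elim ν τ)

theorem exists_eq_vec (x : UVT s → ℝ) : ∃ ξ ν τ, x = vec ξ ν τ :=
  ⟨fun a => x (UVT.u a), fun a => x (UVT.v a), fun a => x (UVT.t a), by
    funext i
    rcases i with i | i | i <;> rfl⟩

theorem vec_add (ξ ν τ ξ' ν' τ' : Fin s → ℝ) :
    vec ξ ν τ + vec ξ' ν' τ' = vec (ξ + ξ') (ν + ν') (τ + τ') := by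
  funext i
  rcases i with i | i | i <;> rfl

theorem smul_vec (c : ℝ) (ξ ν τ : Fin s → ℝ) : c • vec ξ ν τ = vec (c • ξ) (c • ν) (c • τ) := by
  funext i
  rcases i with i | i | i <;> rfl

theorem vec_zero : vec (0 : Fin s → ℝ) 0 0 = 0 := by
  funext i
  rcases i with i | i | i <;> rfl

theorem prod_metric (P : UVT s → ℝ) (ξ ν τ η μ θ : Fin s → ℝ) :
    (metric s).prod P (vec ξ ν τ) (vec η μ θ)
      = potential P * (ξ ⬝ᵥ η) + ξ ⬝ᵥ μ + ν ⬝ᵥ η - τ ⬝ᵥ θ := by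
  simp [prod, metric, Fintype.sum_sum_type, metricComp, dotProduct, Finset.sum_add_distrib,
    Finset.mul_sum, mul_assoc]
  ring

/-- The Jacobi operator of the sphere of curvature one. -/
def sphereJacobi (ξ η : Fin s → ℝ) : Fin s → ℝ := (ξ ⬝ᵥ ξ) • η - (η ⬝ᵥ ξ) • ξ

/-- This and the next three contractions cover the delta products in `curvatureTensor`, in either
order of the factors. -/
theorem sum_delta_left {f g h : Fin s → ℝ} (l : Fin s) :
    ∑ a, ∑ b, ∑ c, ((if a = l then 1 else 0) * (if b = c then 1 else 0)) * f a * g b * h c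
      = f l * (g ⬝ᵥ h) := by
  simp [dotProduct, Finset.mul_sum, mul_assoc]

theorem sum_delta_mid {f g h : Fin s → ℝ} (l : Fin s) :
    ∑ a, ∑ b, ∑ c, ((if b = l then 1 else 0) * (if a = c then 1 else 0)) * f a * g b * h c
      = (f ⬝ᵥ h) * g l := by
  simp [dotProduct, Finset.sum_mul]
  exact Finset.sum_congr rfl fun _ _ => by ring

theorem sum_delta_mid' {f g h : Fin s → ℝ} (l : Fin s) :
    ∑ a, ∑ b, ∑ c, ((if a = c then 1 else 0) * (if b = l then 1 else 0)) * f a * g b * h c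
      = (f ⬝ᵥ h) * g l := by
  simp only [mul_comm (if _ = _ then (1 : ℝ) else 0) (if _ = l then (1 : ℝ) else 0), sum_delta_mid]

theorem sum_delta_left' {f g h : Fin s → ℝ} (l : Fin s) :
    ∑ a, ∑ b, ∑ c, ((if b = c then 1 else 0) * (if a = l then 1 else 0)) * f a * g b * h c
      = f l * (g ⬝ᵥ h) := by
  simp only [mul_comm (if _ = _ then (1 : ℝ) else 0) (if _ = l then (1 : ℝ) else 0), sum_delta_left]

theorem jacobi_metric (P : UVT s → ℝ) (ξ ν τ η μ θ : Fin s → ℝ) :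
    (metric s).jacobi P (vec ξ ν τ) (vec η μ θ)
      = vec 0 ((∑ e, P (UVT.u e) ^ 2) • sphereJacobi ξ η + (η ⬝ᵥ τ) • ξ + (η ⬝ᵥ ξ) • τ
          - (2 * (ξ ⬝ᵥ τ)) • η - sphereJacobi ξ θ) (sphereJacobi ξ η) := by
  funext l
  change (metric s).curvatureOp P _ _ _ l = _
  simp only [curvatureOp, curvatureComp_metric]
  rcases l with l | l | l
  · simp [curvatureTensor]
  · simp only [Fintype.sum_sum_type, curvatureTensor, Sum.elim_inl, Sum.elim_inr, zero_mul,
      Finset.sum_const_zero, add_zero, zero_add, sub_mul, mul_sub, Finset.sum_sub_distrib,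
      Finset.sum_add_distrib, mul_assoc (∑ e, P (UVT.u e) ^ 2), ← Finset.mul_sum,
      sum_delta_left, sum_delta_mid, sum_delta_left', sum_delta_mid']
    simp [sphereJacobi, dotProduct_comm]
    ring
  · simp only [Fintype.sum_sum_type, curvatureTensor, Sum.elim_inl, Sum.elim_inr, zero_mul,
      Finset.sum_const_zero, add_zero, sub_mul, Finset.sum_sub_distrib, sum_delta_left,
      sum_delta_mid]
    simp [sphereJacobi]
    ring

theorem hasQuadraticForm_metric :
    HasQuadraticForm (metric s)
      fun a b c d => 2 * (if a = b then 1 else 0) * (if c = d then 1 else 0) := by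
  intro P a b
  refine ⟨?_, rfl, ?_, rfl, rfl, rfl, rfl, rfl, rfl⟩
  · change (if a = b then potential P else 0) = _
    split_ifs with h <;> simp [potential, h]
  · change (if b = a then (1 : ℝ) else 0) = _
    simp [eq_comm]

theorem sphereJacobi_self (ξ : Fin s → ℝ) : sphereJacobi ξ ξ = 0 := sub_self _

theorem sphereJacobi_zero (ξ : Fin s → ℝ) : sphereJacobi ξ 0 = 0 := by
  simp [sphereJacobi]

theorem sphereJacobi_zero_left (η : Fin s → ℝ) : sphereJacobi 0 η = 0 := by
  simp [sphereJacobi]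

theorem sphereJacobi_of_orthogonal {ξ η : Fin s → ℝ} (h : η ⬝ᵥ ξ = 0) :
    sphereJacobi ξ η = (ξ ⬝ᵥ ξ) • η := by
  simp [sphereJacobi, h]

theorem jacobi_self (P x : UVT s → ℝ) : (metric s).jacobi P x x = 0 := by
  obtain ⟨ξ, ν, τ, rfl⟩ := exists_eq_vec x
  rw [jacobi_metric, ← vec_zero]
  simp only [sphereJacobi_self]
  congr 2
  funext i
  simp [sphereJacobi, dotProduct_comm τ ξ]
  ring

theorem jacobi_vec_v (P x : UVT s → ℝ) (μ : Fin s → ℝ) :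
    (metric s).jacobi P x (vec 0 μ 0) = 0 := by
  obtain ⟨ξ, ν, τ, rfl⟩ := exists_eq_vec x
  simp [jacobi_metric, sphereJacobi_zero, vec_zero]

theorem jacobi_vec_t (P : UVT s → ℝ) (ξ ν τ θ : Fin s → ℝ) :
    (metric s).jacobi P (vec ξ ν τ) (vec 0 0 θ) = vec 0 (-sphereJacobi ξ θ) 0 := by
  simp [jacobi_metric, sphereJacobi_zero]

theorem jacobi_pow_three (P x : UVT s → ℝ) : (metric s).jacobi P x ^ 3 = 0 := by
  obtain ⟨ξ, ν, τ, rfl⟩ := exists_eq_vec x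
  refine LinearMap.ext fun y => ?_
  obtain ⟨η, μ, θ, rfl⟩ := exists_eq_vec y
  simp [pow_succ', Module.End.mul_apply, jacobi_metric, sphereJacobi_zero, vec_zero]

/-- A nonzero vector and a basis of its orthogonal complement span. -/
theorem exists_span_orthogonal {ξ : Fin s → ℝ} (hξ : ξ ≠ 0) :
    ∃ w : Fin (s - 1) → Fin s → ℝ, (∀ i, w i ⬝ᵥ ξ = 0) ∧
      ∀ S : Submodule ℝ (Fin s → ℝ), ξ ∈ S → (∀ i, w i ∈ S) → S = ⊤ := by
  let φ : (Fin s → ℝ) →ₗ[ℝ] ℝ := (dotProductBilin ℝ ℝ).flip ξ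
  have hφ (η) : φ η = η ⬝ᵥ ξ := rfl
  have hne : ξ ⬝ᵥ ξ ≠ 0 := by simpa using hξ
  have hsurj : Function.Surjective φ :=
    LinearMap.surjective fun h => hne (by rw [← hφ, h, LinearMap.zero_apply])
  have hrank : Module.finrank ℝ (LinearMap.ker φ) = s - 1 := by
    have := φ.finrank_range_add_finrank_ker
    rw [LinearMap.range_eq_top.2 hsurj, finrank_top] at this
    simp at this
    omega
  let b := Module.finBasisOfFinrankEq ℝ (LinearMap.ker φ) hrank
  refine ⟨fun i => b i, fun i => (b i).2, fun S hS hw => ?_⟩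
  have hker : LinearMap.ker φ ≤ S := by
    intro η hη
    have h := b.sum_repr ⟨η, hη⟩
    have h' := congrArg Subtype.val h
    simp only [Submodule.coe_sum, Submodule.coe_smul] at h'
    rw [← h']
    exact S.sum_mem fun i _ => S.smul_mem _ (hw i)
  refine Submodule.eq_top_iff'.2 fun η => ?_
  have h : η - ((η ⬝ᵥ ξ) / (ξ ⬝ᵥ ξ)) • ξ ∈ S := hker (by
    rw [LinearMap.mem_ker, hφ, sub_dotProduct, smul_dotProduct, smul_eq_mul,
      div_mul_cancel₀ _ hne, sub_self])
  simpa using S.add_mem h (S.smul_mem ((η ⬝ᵥ ξ) / (ξ ⬝ᵥ ξ)) hS)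

/-- Each w ⊥ ξ, placed in the u-part, starts a chain of length three. The blocks of size one are x
itself and ξ placed in the v- and in the t-part; the count is 3(s - 1) + 3 = 3s. -/
theorem hasJordanForm_jacobi (P : UVT s → ℝ) {ξ : Fin s → ℝ} (hξ : ξ ≠ 0) (ν τ : Fin s → ℝ) :
    HasJordanForm ((metric s).jacobi P (vec ξ ν τ)) (JordanData.threeOne (s - 1) 3) := by
  obtain ⟨w, hw, hspan⟩ := exists_span_orthogonal hξ
  have hne : ξ ⬝ᵥ ξ ≠ 0 := by simpa using hξ
  have hs : 0 < s := Nat.pos_of_ne_zero (by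
    rintro rfl
    exact hξ (Subsingleton.elim _ _))
  set A := (metric s).jacobi P (vec ξ ν τ) with hA
  have hAw (i) : ∃ μ, A (vec (w i) 0 0) = vec 0 μ ((ξ ⬝ᵥ ξ) • w i) :=
    ⟨_, by rw [hA, jacobi_metric, sphereJacobi_of_orthogonal (hw i)]⟩
  have hAAw (i) : A (A (vec (w i) 0 0)) = vec 0 (-((ξ ⬝ᵥ ξ) ^ 2 • w i)) 0 := by
    obtain ⟨μ, hμ⟩ := hAw i
    rw [hμ, hA, jacobi_metric, sphereJacobi_of_orthogonal (η := (ξ ⬝ᵥ ξ) • w i) (by simp [hw])]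
    simp [sphereJacobi_zero, smul_smul, pow_two]
  refine HasJordanForm.threeOne (fun i => vec (w i) 0 0)
    ![vec ξ ν τ, vec 0 ξ 0, vec 0 0 ξ] (fun i => ?_) (fun i => ?_) ?_ ?_
  · rw [hAAw, hA, jacobi_vec_v]
  · fin_cases i
    · exact jacobi_self P _
    · exact jacobi_vec_v P _ ξ
    · change A (vec 0 0 ξ) = 0
      rw [hA, jacobi_vec_t, sphereJacobi_self, neg_zero, vec_zero]
  · simp
    omega
  · intro S h₀ h₁ h₂ hz
    have hx : vec ξ ν τ ∈ S := hz 0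
    -- The v-part must come first: the chain ends are -|ξ|⁴ w there. The middle chain vectors give
    -- the t-part only modulo v, and x gives ξ in the u-part only modulo v and t.
    have hv (μ) : vec 0 μ 0 ∈ S := by
      let f : (Fin s → ℝ) →ₗ[ℝ] (UVT s → ℝ) :=
        { toFun := fun μ => vec 0 μ 0
          map_add' := fun _ _ => by simp [vec_add]
          map_smul' := fun _ _ => by simp [smul_vec] }
      have : S.comap f = ⊤ := hspan _ (hz 1) fun i => by
        have h := S.smul_mem (-((ξ ⬝ᵥ ξ) ^ 2)⁻¹) (h₂ i)
        rw [hAAw, smul_vec, smul_zero, smul_neg, neg_smul, neg_neg, smul_smul,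
          inv_mul_cancel₀ (pow_ne_zero 2 hne), one_smul] at h
        exact h
      exact Submodule.eq_top_iff'.1 this μ
    have ht (θ) : vec 0 0 θ ∈ S := by
      let f : (Fin s → ℝ) →ₗ[ℝ] (UVT s → ℝ) :=
        { toFun := fun θ => vec 0 0 θ
          map_add' := fun _ _ => by simp [vec_add]
          map_smul' := fun _ _ => by simp [smul_vec] }
      have : S.comap f = ⊤ := hspan _ (hz 2) fun i => by
        obtain ⟨μ, hμ⟩ := hAw i
        have h := S.smul_mem (ξ ⬝ᵥ ξ)⁻¹ (S.add_mem (h₁ i) (hv (-μ)))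
        rw [hμ, vec_add, smul_vec, add_zero, add_neg_cancel, add_zero, smul_zero, smul_smul,
          inv_mul_cancel₀ hne, one_smul] at h
        exact h
      exact Submodule.eq_top_iff'.1 this θ
    have hu (η) : vec η 0 0 ∈ S := by
      let f : (Fin s → ℝ) →ₗ[ℝ] (UVT s → ℝ) :=
        { toFun := fun η => vec η 0 0
          map_add' := fun _ _ => by simp [vec_add]
          map_smul' := fun _ _ => by simp [smul_vec] }
      have : S.comap f = ⊤ := hspan _ (by
        have h := S.add_mem hx (S.add_mem (hv (-ν)) (ht (-τ)))
        simp only [vec_add, add_zero, zero_add, add_neg_cancel] at h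
        exact h) h₀
      exact Submodule.eq_top_iff'.1 this η
    refine Submodule.eq_top_iff'.2 fun y => ?_
    obtain ⟨η, μ, θ, rfl⟩ := exists_eq_vec y
    simpa [vec_add] using S.add_mem (hu η) (S.add_mem (hv μ) (ht θ))

/-- With ξ = 0 the square of x would be -|τ|² ≤ 0, so `hasJordanForm_jacobi` applies to every unit
spacelike vector. -/
theorem isSpacelikeJordanOsserman_metric : (metric s).IsSpacelikeJordanOsserman := by
  refine ⟨JordanData.threeOne (s - 1) 3, fun P x hx => ?_⟩
  obtain ⟨ξ, ν, τ, rfl⟩ := exists_eq_vec x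
  refine hasJordanForm_jacobi P ?_ ν τ
  rintro rfl
  rw [prod_metric] at hx
  have : 0 ≤ τ ⬝ᵥ τ := by simpa using dotProduct_star_self_nonneg τ
  simp at hx
  linarith

theorem sphereJacobi_single {a b : Fin s} (h : a ≠ b) :
    sphereJacobi (Pi.single a 1) (Pi.single b 1) = Pi.single b 1 := by
  simp [sphereJacobi, h]

/-- The square sends U_b to -V_b. -/
theorem jacobi_sq_ne_zero {a b : Fin s} (h : a ≠ b) (P : UVT s → ℝ) (ν τ : Fin s → ℝ) :
    (metric s).jacobi P (vec (Pi.single a 1) ν τ) ^ 2 ≠ 0 := by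
  intro hzero
  have := congrFun (LinearMap.congr_fun hzero (vec (Pi.single b 1) 0 0)) (UVT.v b)
  simp [pow_two, Module.End.mul_apply, jacobi_metric, sphereJacobi_single h,
    sphereJacobi_zero] at this

theorem isNilpotentOssermanOfOrder_metric (hs : 2 ≤ s) :
    (metric s).IsNilpotentOssermanOfOrder 3 := by
  refine ⟨fun P x => pow_eq_zero_of_le ?_ (jacobi_pow_three P x), IsGreatest.isLUB ⟨?_, ?_⟩⟩
  · simp
    omega
  · refine ⟨0, vec (Pi.single ⟨0, by omega⟩ 1) 0 0, ?_⟩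
    refine (nilpotencyClass_eq_succ_iff.2 ⟨jacobi_pow_three _ _, ?_⟩).symm
    exact jacobi_sq_ne_zero (b := ⟨1, by omega⟩) (by simp) _ _ _
  · rintro m ⟨P, x, rfl⟩
    exact csInf_le' (jacobi_pow_three P x)

theorem not_isTimelikeJordanOsserman_metric (hs : 2 ≤ s) :
    ¬ (metric s).IsTimelikeJordanOsserman := by
  rintro ⟨D, hD⟩
  let a : Fin s := ⟨0, by omega⟩
  let b : Fin s := ⟨1, by omega⟩
  -- T_a is unit timelike with no u-part.
  have h₀ : (metric s).jacobi 0 (vec 0 0 (Pi.single a 1)) = 0 := by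
    refine LinearMap.ext fun y => ?_
    obtain ⟨η, μ, θ, rfl⟩ := exists_eq_vec y
    simp [jacobi_metric, sphereJacobi_zero_left, vec_zero]
  have h₁ := hD 0 (vec 0 0 (Pi.single a 1)) (by rw [prod_metric]; simp)
  -- At the origin the potential vanishes, so U_a - V_a/2 has square 2 · (-1/2) = -1, with nonzero
  -- u-part.
  have h₂ := hD 0 (vec (Pi.single a 1) (Pi.single a (-1 / 2)) 0) (by
    rw [prod_metric]
    simp [potential])
  rw [h₀] at h₁
  refine jacobi_sq_ne_zero (a := a) (b := b) (by simp [a, b]) 0 (Pi.single a (-1 / 2)) 0 ?_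
  rw [h₁.eq_zero_of_zero h₂, zero_pow two_ne_zero]

/-! ### The signature. -/

/-- The standard orthonormal frame of `metric`. -/
noncomputable def frame (P : UVT s → ℝ) : (Fin s ⊕ Fin s) ⊕ Fin s → UVT s → ℝ
  | .inl (.inl a) => vec (Pi.single a 1) (Pi.single a ((-1 - potential P) / 2)) 0
  | .inl (.inr a) => vec 0 0 (Pi.single a 1)
  | .inr a => vec (Pi.single a 1) (Pi.single a ((1 - potential P) / 2)) 0

/-- The squares of the vectors of `frame`. -/
def frameSign : (Fin s ⊕ Fin s) ⊕ Fin s → ℝ := Sum.elim (fun _ => -1) (fun _ => 1)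

/-- With f the potential, g(U_a + cV_a, U_a + c'V_a) = f + c + c'. The coefficients (±1 - f)/2 make
this ±1 for c = c' and 0 for opposite signs. -/
theorem prod_frame (P : UVT s → ℝ) (i j) :
    (metric s).prod P (frame P i) (frame P j) = if i = j then frameSign i else 0 := by
  rcases i with (i | i) | i <;> rcases j with (j | j) | j <;>
    simp only [frame, prod_metric] <;> simp [frameSign, Pi.single_apply, eq_comm]
  all_goals split_ifs <;> ring

/-- The linear functional `g_P(·, y)`. -/
def prodRight {ι : Type*} [Fintype ι] [DecidableEq ι] (g : PseudoRiemannianMetric ι)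
    (P y : ι → ℝ) : (ι → ℝ) →ₗ[ℝ] ℝ where
  toFun x := g.prod P x y
  map_add' x x' := by
    simp only [prod, Pi.add_apply, mul_add, add_mul, Finset.sum_add_distrib]
  map_smul' c x := by
    simp only [prod, Pi.smul_apply, smul_eq_mul, RingHom.id_apply, Finset.mul_sum]
    exact Finset.sum_congr rfl fun i _ => Finset.sum_congr rfl fun j _ => by ring

/-- Pairing a linear relation with the i-th frame vector leaves only its i-th coefficient, up to
sign. -/
theorem linearIndependent_frame (P : UVT s → ℝ) : LinearIndependent ℝ (frame P) := by
  rw [Fintype.linearIndependent_iff]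
  intro c hc i
  have h := congrArg (prodRight (metric s) P (frame P i)) hc
  simp only [map_sum, map_smul, map_zero, smul_eq_mul] at h
  have hframe (j) : prodRight (metric s) P (frame P i) (frame P j)
      = if j = i then frameSign j else 0 := prod_frame P j i
  have hi : frameSign i ≠ 0 := by rcases i with i | i <;> simp [frameSign]
  simpa [hframe, hi] using h

theorem hasSignature_metric (hs : 0 < s) : (metric s).HasSignature (2 * s) s := by
  intro P
  let e : (Fin s ⊕ Fin s) ⊕ Fin s ≃ Fin (2 * s) ⊕ Fin s :=
    Equiv.sumCongr (finSumFinEquiv.trans (finCongr (two_mul s).symm)) (Equiv.refl _)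
  have hcard : Fintype.card ((Fin s ⊕ Fin s) ⊕ Fin s) = Module.finrank ℝ (UVT s → ℝ) := by
    simp
    ring
  have : Nonempty ((Fin s ⊕ Fin s) ⊕ Fin s) := ⟨.inr ⟨0, hs⟩⟩
  let b := (basisOfLinearIndependentOfCardEqFinrank (linearIndependent_frame P) hcard).reindex e
  have hb (i) : b i = frame P (e.symm i) := by simp [b]
  refine ⟨b, fun i j hij => ?_, fun i => ?_, fun i => ?_⟩
  · rw [hb, hb, prod_frame, if_neg (e.symm.injective.ne hij)]
  · rw [hb, prod_frame, if_pos rfl]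
    simp [e, frameSign]
  · rw [hb, prod_frame, if_pos rfl]
    simp [e, frameSign]

end WalkerMetric

open WalkerMetric in
theorem theorem1p1 (s : ℕ) (hs : 2 ≤ s) :
    ∃ (g : PseudoRiemannianMetric (UVT s)) (ψ : Fin s → Fin s → Fin s → Fin s → ℝ),
      HasQuadraticForm g ψ ∧
      g.HasSignature (2 * s) s ∧
      g.IsSpacelikeJordanOsserman ∧
      g.IsNilpotentOssermanOfOrder 3 ∧
      ¬ g.IsTimelikeJordanOsserman :=
  ⟨metric s, _, hasQuadraticForm_metric, hasSignature_metric (by omega),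
    isSpacelikeJordanOsserman_metric,
    isNilpotentOssermanOfOrder_metric hs, not_isTimelikeJordanOsserman_metric hs⟩
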